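/- Let $X$ be a finite-dimensional smooth manifold (without boundary), $\eta$ a closed $3$-form on $X$, $\Omega(X)=\bigoplus_k\Omega^k(X)$ the space of smooth differential forms, and $D=d-\eta$, i.e. $D\theta=d\theta-\eta\wedge\theta$. Then $D^2=0$. Filter $\Omega(X)$ by $F^p=\bigoplus_{k\ge p}\Omega^k(X)$ and let $(E_r^p,d_r)$ be the resulting spectral sequence: $$E_r^p=Z_r^p\big/\bigl(Z_r^p\cap(F^{p+1}+DF^{p-r+1})\bigr),\qquad Z_r^p=\{z\in F^p: Dz\in F^{p+r}\},$$ where $F^q=\Omega(X)$ for $q\le 0$ and $d_r:E_r^p\to E_r^{p+r}$ is induced by $D$. Say that $u\in E_r^p$ is represented by $c\in H^p(X;\mathbb R)$ (de Rham cohomology) if $u$ is the class of some $z\in Z_r^p$ whose component of degree $p$ is a closed form in the class $c$. For $c\in H^p(X;\mathbb R)$ and $m\ge 0$ the iterated Massey product $\{\eta,\dots,\eta,c\}$ with $m+1$ entries $\eta$ is the set of all classes $[\eta\wedge a_m]\in H^{p+2m+3}(X;\mathbb R)$, where $a_j\in\Omega^{p+2j}(X)$ for $0\le j\le m$, $a_0$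 is a closed form in the class $c$, and $da_{j+1}=\eta\wedge a_j$ for $0\le j<m$. It is defined if this set is non-empty. For $m=0$ it is $[\eta]c$. Then: 1. For $r=2$ and $r=3$ there are linear isomorphisms $H^p(X;\mathbb R)\cong E_r^p$ for all $p\ge 0$, under which each class $c$ represents its image. Under the isomorphism for $r=3$ the differential $d_3$ is $[x]\mapsto-[\eta\wedge x]$. 2. $d_r=0$ for every even $r$. 3. For all $m\ge0$, $p\ge 0$: every $u\in E_{2m+3}^p$ is represented by some $c\in H^p(X;\mathbb R)$, and a class $c$ represents at most one $u\in E_{2m+3}^p$. It represents one if and only if the Massey product $\{\eta,\dots,\eta,c\}$ with $m+1$ entries $\eta$ is defined. In that case $d_{2m+3}u$ is represented by $-\mu$ for every $\mu\in\{\eta,\dots,\eta,c\}$, that is, $$d_{2m+3}[c]=-\{\underbrace{\eta,\dots,\eta}_{m+1},c\}.$$ -/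

import Mathlib

open scoped Manifold ContDiff DirectSum Topology

noncomputable section

/-! ### The exterior product of alternating forms -/

namespace AlternatingForm

section Topological

variable {V : Type*} [AddCommGroup V] [Module ℝ V] [TopologicalSpace V]

/-- The exterior product of an alternating `k`-form and an alternating `l`-form, in the shuffle
normalization: the value at `v` is the sum over `(k, l)`-shuffles `σ` of
`sign σ * α (v ∘ σ restricted to the first k) * β (v ∘ σ restricted to the last l)`. -/
def wedgeAlg {k l : ℕ} (α : V [⋀^Fin k]→L[ℝ] ℝ) (β : V [⋀^Fin l]→L[ℝ] ℝ) :
    V [⋀^Fin (k + l)]→ₗ[ℝ] ℝ :=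
  ((LinearMap.mul' ℝ ℝ).compAlternatingMap
    (α.toAlternatingMap.domCoprod β.toAlternatingMap)).domDomCongr finSumFinEquiv

/-- One shuffle term of the exterior product. -/
def wedgeTerm {k l : ℕ} (α : V [⋀^Fin k]→L[ℝ] ℝ) (β : V [⋀^Fin l]→L[ℝ] ℝ)
    (σ : Equiv.Perm (Fin k ⊕ Fin l)) (v : Fin (k + l) → V) : ℝ :=
  ((Equiv.Perm.sign σ : ℤ) : ℝ) *
    (α (fun i => v (finSumFinEquiv (σ (Sum.inl i)))) *
      β (fun j => v (finSumFinEquiv (σ (Sum.inr j)))))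

theorem wedgeAlg_apply {k l : ℕ} (α : V [⋀^Fin k]→L[ℝ] ℝ) (β : V [⋀^Fin l]→L[ℝ] ℝ)
    (v : Fin (k + l) → V) :
    wedgeAlg α β v =
      ∑ σ : Equiv.Perm.ModSumCongr (Fin k) (Fin l), wedgeTerm α β σ.out v := by
  unfold wedgeAlg
  simp only [AlternatingMap.domDomCongr_apply, LinearMap.compAlternatingMap_apply,
    AlternatingMap.domCoprod_apply, map_sum, sum_apply]
  refine Finset.sum_congr rfl fun σ _ => ?_
  conv_lhs => rw [← Quotient.out_eq' σ]
  rw [AlternatingMap.domCoprod.summand_mk'']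
  rw [Units.smul_def, smul_apply, MultilinearMap.domDomCongr_apply, map_zsmul,
    zsmul_eq_mul]
  rfl

/-- The exterior product of continuous alternating forms. -/
def wedge {k l : ℕ} (α : V [⋀^Fin k]→L[ℝ] ℝ) (β : V [⋀^Fin l]→L[ℝ] ℝ) :
    V [⋀^Fin (k + l)]→L[ℝ] ℝ :=
  { wedgeAlg α β with
    cont := by
      change Continuous fun v => wedgeAlg α β v
      simp only [wedgeAlg_apply, wedgeTerm]
      fun_prop }

theorem wedge_apply {k l : ℕ} (α : V [⋀^Fin k]→L[ℝ] ℝ) (β : V [⋀^Fin l]→L[ℝ] ℝ)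
    (v : Fin (k + l) → V) :
    wedge α β v = ∑ σ : Equiv.Perm.ModSumCongr (Fin k) (Fin l), wedgeTerm α β σ.out v :=
  wedgeAlg_apply α β v

/-- The exterior product commutes with linear pullback. -/
theorem wedge_comp {W : Type*} [AddCommGroup W] [Module ℝ W] [TopologicalSpace W] {k l : ℕ}
    (α : V [⋀^Fin k]→L[ℝ] ℝ) (β : V [⋀^Fin l]→L[ℝ] ℝ) (f : W →L[ℝ] V) :
    (wedge α β).compContinuousLinearMap f =
      wedge (α.compContinuousLinearMap f) (β.compContinuousLinearMap f) := by
  ext v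
  simp [wedge_apply, wedgeTerm, Function.comp_def]

/-- The exterior product as a bilinear map. -/
def wedgeBilin (k l : ℕ) :
    (V [⋀^Fin k]→L[ℝ] ℝ) →ₗ[ℝ] (V [⋀^Fin l]→L[ℝ] ℝ) →ₗ[ℝ] (V [⋀^Fin (k + l)]→L[ℝ] ℝ) :=
  LinearMap.mk₂ ℝ wedge
    (fun α α' β => by
      ext v; simp [wedge_apply, wedgeTerm, add_mul, mul_add, Finset.sum_add_distrib])
    (fun c α β => by
      ext v; simp [wedge_apply, wedgeTerm, Finset.mul_sum, mul_left_comm, mul_assoc])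
    (fun α β β' => by
      ext v; simp [wedge_apply, wedgeTerm, mul_add, Finset.sum_add_distrib])
    (fun c α β => by
      ext v; simp [wedge_apply, wedgeTerm, Finset.mul_sum, mul_left_comm])

end Topological

theorem norm_wedgeTerm_le {V : Type*} [NormedAddCommGroup V] [NormedSpace ℝ V] {k l : ℕ}
    (α : V [⋀^Fin k]→L[ℝ] ℝ) (β : V [⋀^Fin l]→L[ℝ] ℝ) (σ : Equiv.Perm (Fin k ⊕ Fin l))
    (v : Fin (k + l) → V) : ‖wedgeTerm α β σ v‖ ≤ ‖α‖ * ‖β‖ * ∏ i, ‖v i‖ := by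
  have h1 := α.le_opNorm (fun i => v (finSumFinEquiv (σ (Sum.inl i))))
  have h2 := β.le_opNorm (fun j => v (finSumFinEquiv (σ (Sum.inr j))))
  have hs : ‖((Equiv.Perm.sign σ : ℤ) : ℝ)‖ = 1 := by
    rcases Int.units_eq_one_or (Equiv.Perm.sign σ) with h | h <;> simp [h]
  have hp : ∏ i, ‖v i‖ = (∏ i, ‖v (finSumFinEquiv (σ (Sum.inl i)))‖) *
      ∏ j, ‖v (finSumFinEquiv (σ (Sum.inr j)))‖ := by
    rw [← Fintype.prod_sumElim]
    rw [← (Equiv.trans σ finSumFinEquiv).prod_comp]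
    refine Finset.prod_congr rfl fun s _ => ?_
    cases s <;> rfl
  rw [wedgeTerm, norm_mul, hs, one_mul, norm_mul, hp]
  calc _ ≤ (‖α‖ * ∏ i, ‖v (finSumFinEquiv (σ (Sum.inl i)))‖) *
        (‖β‖ * ∏ j, ‖v (finSumFinEquiv (σ (Sum.inr j)))‖) := by gcongr
    _ = _ := by ring

theorem norm_wedge_le {V : Type*} [NormedAddCommGroup V] [NormedSpace ℝ V] {k l : ℕ}
    (α : V [⋀^Fin k]→L[ℝ] ℝ) (β : V [⋀^Fin l]→L[ℝ] ℝ) :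
    ‖wedge α β‖ ≤ (Fintype.card (Equiv.Perm.ModSumCongr (Fin k) (Fin l)) : ℝ) * ‖α‖ * ‖β‖ := by
  refine ContinuousAlternatingMap.opNorm_le_bound _ (by positivity) fun v => ?_
  rw [wedge_apply]
  have key : ∀ σ : Equiv.Perm.ModSumCongr (Fin k) (Fin l),
      ‖wedgeTerm α β σ.out v‖ ≤ ‖α‖ * ‖β‖ * ∏ i, ‖v i‖ := by
    intro σ
    exact norm_wedgeTerm_le α β σ.out v
  calc _ ≤ ∑ σ : Equiv.Perm.ModSumCongr (Fin k) (Fin l), ‖wedgeTerm α β σ.out v‖ :=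
        norm_sum_le _ _
    _ ≤ ∑ _σ : Equiv.Perm.ModSumCongr (Fin k) (Fin l), ‖α‖ * ‖β‖ * ∏ i, ‖v i‖ :=
        Finset.sum_le_sum fun σ _ => key σ
    _ = _ := by
        rw [Finset.sum_const, nsmul_eq_mul, Finset.card_univ]
        ring

/-- The exterior product as a continuous bilinear map. -/
def wedgeCLM (V : Type*) [NormedAddCommGroup V] [NormedSpace ℝ V] (k l : ℕ) :
    (V [⋀^Fin k]→L[ℝ] ℝ) →L[ℝ] (V [⋀^Fin l]→L[ℝ] ℝ) →L[ℝ] (V [⋀^Fin (k + l)]→L[ℝ] ℝ) :=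
  LinearMap.mkContinuous₂ (wedgeBilin k l) _ norm_wedge_le

end AlternatingForm

/-! ### Differential forms on a manifold -/

section Forms

variable {E : Type*} [NormedAddCommGroup E] [NormedSpace ℝ E]
  {X : Type*} [TopologicalSpace X] [ChartedSpace E X]

/-- The expression in the chart `e` of a (not necessarily smooth) field `θ` of alternating forms
on the tangent spaces of `X`: the pullback of `θ` along `e.symm`. It is meaningful on `e.target`. -/
def formInChart {k : ℕ} (θ : ∀ x : X, TangentSpace 𝓘(ℝ, E) x [⋀^Fin k]→L[ℝ] ℝ)
    (e : OpenPartialHomeomorph X E) (y : E) : E [⋀^Fin k]→L[ℝ] ℝ :=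
  (θ (e.symm y)).compContinuousLinearMap
    (mfderiv 𝓘(ℝ, E) 𝓘(ℝ, E) e.symm y : E →L[ℝ] TangentSpace 𝓘(ℝ, E) (e.symm y))

variable (E X) in
/-- The fields of alternating `k`-forms on the tangent spaces of `X` that are smooth in every chart
of the atlas. -/
def smoothForms (k : ℕ) :
    Submodule ℝ (∀ x : X, TangentSpace 𝓘(ℝ, E) x [⋀^Fin k]→L[ℝ] ℝ) where
  carrier := {θ | ∀ e ∈ atlas E X, ContDiffOn ℝ ∞ (formInChart θ e) e.target}
  add_mem' h h' e he := (h e he).add (h' e he)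
  zero_mem' _ _ := contDiffOn_const (c := 0)
  smul_mem' c _ h e he := (h e he).const_smul c

variable (E X) in
/-- The real vector space `Ω^k(X)` of smooth differential `k`-forms on `X`. -/
def DiffForm (k : ℕ) : Type _ := smoothForms E X k

instance (k : ℕ) : AddCommGroup (DiffForm E X k) :=
  inferInstanceAs (AddCommGroup (smoothForms E X k))

instance (k : ℕ) : Module ℝ (DiffForm E X k) :=
  inferInstanceAs (Module ℝ (smoothForms E X k))

/-- The exterior product of smooth forms. -/
def DiffForm.wedge {k l : ℕ} (α : DiffForm E X k) (β : DiffForm E X l) : DiffForm E X (k + l) :=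
  ⟨fun x => AlternatingForm.wedge (α.1 x) (β.1 x), fun e he => by
    have h : formInChart (fun x : X => AlternatingForm.wedge (α.1 x) (β.1 x)) e = fun y =>
        AlternatingForm.wedgeCLM E k l (formInChart α.1 e y) (formInChart β.1 e y) :=
      funext fun y => AlternatingForm.wedge_comp _ _ _
    rw [h]
    exact ((AlternatingForm.wedgeCLM E k l).contDiff.comp_contDiffOn (α.2 e he)).clm_apply
      (β.2 e he)⟩

theorem formInChart_eqOn [IsManifold 𝓘(ℝ, E) ∞ X] {k : ℕ}
    (θ : ∀ x : X, TangentSpace 𝓘(ℝ, E) x [⋀^Fin k]→L[ℝ] ℝ)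
    {e e' : OpenPartialHomeomorph X E} (he : e ∈ atlas E X) (he' : e' ∈ atlas E X)
    {y : E} (hy : y ∈ e.target) (hy' : e.symm y ∈ e'.source) :
    formInChart θ e y = (formInChart θ e' (e' (e.symm y))).compContinuousLinearMap
      (fderiv ℝ (e' ∘ e.symm) y) := by
  have : IsManifold 𝓘(ℝ, E) 1 X := IsManifold.of_le (n := ∞) (by norm_num)
  have h1 : MDifferentiableAt 𝓘(ℝ, E) 𝓘(ℝ, E) e.symm y := mdifferentiableAt_atlas_symm he hy
  have h2 : MDifferentiableAt 𝓘(ℝ, E) 𝓘(ℝ, E) e' (e.symm y) := mdifferentiableAt_atlas he' hy'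
  have h3 : MDifferentiableAt 𝓘(ℝ, E) 𝓘(ℝ, E) e'.symm (e' (e.symm y)) :=
    mdifferentiableAt_atlas_symm he' (e'.map_source hy')
  have hev : (e.symm : E → X) =ᶠ[𝓝 y] e'.symm ∘ (e' ∘ e.symm) := by
    have ho := (e.symm.trans e').open_source.mem_nhds (x := y) ⟨hy, hy'⟩
    filter_upwards [ho] with z hz
    exact (e'.left_inv hz.2).symm
  have hd : (mfderiv 𝓘(ℝ, E) 𝓘(ℝ, E) e.symm y : E →L[ℝ] E) =
      (mfderiv 𝓘(ℝ, E) 𝓘(ℝ, E) e'.symm (e' (e.symm y)) : E →L[ℝ] E).comp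
        (fderiv ℝ (e' ∘ e.symm) y) := by
    have h4 := hev.mfderiv_eq.trans
      (mfderiv_comp y (g := e'.symm) (f := e' ∘ e.symm) h3 (h2.comp y h1))
    have h5 : mfderiv 𝓘(ℝ, E) 𝓘(ℝ, E) (e' ∘ e.symm) y = fderiv ℝ (e' ∘ e.symm) y :=
      mfderiv_eq_fderiv
    exact h4.trans (congrArg (fun t : E →L[ℝ] E =>
      (mfderiv 𝓘(ℝ, E) 𝓘(ℝ, E) e'.symm (e' (e.symm y)) : E →L[ℝ] E).comp t) h5)
  have hp : ∀ p q : X, p = q → ∀ w : Fin k → E,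
      (θ p : E [⋀^Fin k]→L[ℝ] ℝ) w = (θ q : E [⋀^Fin k]→L[ℝ] ℝ) w := by
    rintro p _ rfl w; rfl
  ext v
  change (θ (e.symm y) : E [⋀^Fin k]→L[ℝ] ℝ)
      ((mfderiv 𝓘(ℝ, E) 𝓘(ℝ, E) e.symm y : E →L[ℝ] E) ∘ v) =
    (θ (e'.symm (e' (e.symm y))) : E [⋀^Fin k]→L[ℝ] ℝ)
      ((mfderiv 𝓘(ℝ, E) 𝓘(ℝ, E) e'.symm (e' (e.symm y)) : E →L[ℝ] E) ∘
        (fderiv ℝ (e' ∘ e.symm) y ∘ v))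
  rw [hd]
  exact hp _ _ (e'.left_inv hy').symm _

/-- The exterior derivative of a field of alternating forms: at `x` it is the pullback, along the
preferred chart at `x`, of the exterior derivative of the expression in that chart. -/
def extDAt {k : ℕ} (θ : ∀ x : X, TangentSpace 𝓘(ℝ, E) x [⋀^Fin k]→L[ℝ] ℝ) (x : X) :
    TangentSpace 𝓘(ℝ, E) x [⋀^Fin (k + 1)]→L[ℝ] ℝ :=
  (extDeriv (formInChart θ (chartAt E x)) (chartAt E x x)).compContinuousLinearMap
    (mfderiv 𝓘(ℝ, E) 𝓘(ℝ, E) (chartAt E x) x : TangentSpace 𝓘(ℝ, E) x →L[ℝ] E)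

/-- In every chart of the atlas, the exterior derivative of a smooth form is
the exterior derivative of the expression of the form in the chart. -/
theorem formInChart_extDAt [IsManifold 𝓘(ℝ, E) ∞ X] {k : ℕ} (θ : DiffForm E X k)
    {e : OpenPartialHomeomorph X E} (he : e ∈ atlas E X) {y : E} (hy : y ∈ e.target) :
    formInChart (extDAt θ.1) e y = extDeriv (formInChart θ.1 e) y := by
  have : IsManifold 𝓘(ℝ, E) 1 X := IsManifold.of_le (n := ∞) (by norm_num)
  set x := e.symm y with hx
  set c := chartAt E x with hc
  have hca : c ∈ atlas E X := chart_mem_atlas E x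
  have hxc : x ∈ c.source := mem_chart_source E x
  have h1 : MDifferentiableAt 𝓘(ℝ, E) 𝓘(ℝ, E) e.symm y := mdifferentiableAt_atlas_symm he hy
  have h2 : MDifferentiableAt 𝓘(ℝ, E) 𝓘(ℝ, E) c x := mdifferentiableAt_atlas hca hxc
  have hsrc : (e.symm.trans c).source ∈ 𝓝 y :=
    (e.symm.trans c).open_source.mem_nhds ⟨hy, hxc⟩
  have hev : formInChart θ.1 e =ᶠ[𝓝 y] fun z =>
      (formInChart θ.1 c ((c ∘ e.symm) z)).compContinuousLinearMap
        (fderiv ℝ (c ∘ e.symm) z) := by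
    filter_upwards [hsrc] with z hz
    exact formInChart_eqOn θ.1 he hca hz.1 hz.2
  have hsm : ContDiffAt ℝ ∞ (c ∘ e.symm) y := by
    rw [← contMDiffAt_iff_contDiffAt]
    exact (contMDiffAt_of_mem_maximalAtlas (IsManifold.subset_maximalAtlas hca) hxc).comp y
      (contMDiffAt_symm_of_mem_maximalAtlas (IsManifold.subset_maximalAtlas he) hy)
  have hdf : DifferentiableAt ℝ (formInChart θ.1 c) ((c ∘ e.symm) y) :=
    ((θ.2 c hca).contDiffAt (c.open_target.mem_nhds (c.map_source hxc))).differentiableAt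
      (by norm_num)
  have h2le : minSmoothness ℝ 2 ≤ (∞ : WithTop ℕ∞) := by
    rw [minSmoothness_of_isRCLikeNormedField]
    exact WithTop.coe_le_coe.2 (le_top : (2 : ℕ∞) ≤ ⊤)
  have h4 := mfderiv_comp (I := 𝓘(ℝ, E)) (I' := 𝓘(ℝ, E)) (I'' := 𝓘(ℝ, E)) y h2 h1
  have h5 : mfderiv 𝓘(ℝ, E) 𝓘(ℝ, E) (c ∘ e.symm) y = fderiv ℝ (c ∘ e.symm) y :=
    mfderiv_eq_fderiv
  rw [hev.extDeriv_eq, extDeriv_pullback hdf hsm h2le]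
  exact congrArg (fun t : E →L[ℝ] E =>
    (extDeriv (formInChart θ.1 c) (c x)).compContinuousLinearMap t) (h4.symm.trans h5)

/-- The exterior derivative `d : Ω^k(X) → Ω^{k+1}(X)`. -/
def extD [IsManifold 𝓘(ℝ, E) ∞ X] (k : ℕ) : DiffForm E X k →ₗ[ℝ] DiffForm E X (k + 1) where
  toFun θ := ⟨extDAt θ.1, fun e he => by
    have h : ContDiffOn ℝ ∞ (extDeriv (formInChart θ.1 e)) e.target := by
      have := (θ.2 e he).fderiv_of_isOpen e.open_target (m := ∞) (by simp)
      exact (ContinuousAlternatingMap.alternatizeUncurryFinCLM ℝ E ℝ).contDiff.comp_contDiffOn this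
    exact h.congr fun y hy => formInChart_extDAt θ he hy⟩
  map_add' θ θ' := by
    refine Subtype.ext (funext fun x => ?_)
    have hd : ∀ τ : DiffForm E X k,
        DifferentiableAt ℝ (formInChart τ.1 (chartAt E x)) (chartAt E x x) := fun τ =>
      ((τ.2 _ (chart_mem_atlas E x)).contDiffAt
        ((chartAt E x).open_target.mem_nhds (mem_chart_target E x))).differentiableAt (by norm_num)
    have h := extDeriv_add (hd θ) (hd θ')
    exact congrArg (fun t : E [⋀^Fin (k + 1)]→L[ℝ] ℝ => t.compContinuousLinearMap
      (mfderiv 𝓘(ℝ, E) 𝓘(ℝ, E) (chartAt E x) x : TangentSpace 𝓘(ℝ, E) x →L[ℝ] E)) h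
  map_smul' c θ := by
    refine Subtype.ext (funext fun x => ?_)
    have h := extDeriv_smul (x := chartAt E x x) c (formInChart θ.1 (chartAt E x))
    exact congrArg (fun t : E [⋀^Fin (k + 1)]→L[ℝ] ℝ => t.compContinuousLinearMap
      (mfderiv 𝓘(ℝ, E) 𝓘(ℝ, E) (chartAt E x) x : TangentSpace 𝓘(ℝ, E) x →L[ℝ] E)) h

/-- Left exterior multiplication by a form, in a fixed degree. -/
def DiffForm.wedgeLeft {k : ℕ} (α : DiffForm E X k) (l : ℕ) :
    DiffForm E X l →ₗ[ℝ] DiffForm E X (k + l) where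
  toFun β := α.wedge β
  map_add' β β' := Subtype.ext <| funext fun x =>
    (AlternatingForm.wedgeBilin k l (α.1 x)).map_add (β.1 x) (β'.1 x)
  map_smul' c β := Subtype.ext <| funext fun x =>
    (AlternatingForm.wedgeBilin k l (α.1 x)).map_smul c (β.1 x)

/-! ### The de Rham complex, its cohomology, and the twisted differential -/

variable (E X) in
/-- The space `Ω(X)` of all (inhomogeneous) smooth differential forms. -/
def DeRham : Type _ := ⨁ k : ℕ, DiffForm E X k

instance : AddCommGroup (DeRham E X) := inferInstanceAs (AddCommGroup (⨁ k : ℕ, DiffForm E X k))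

instance : Module ℝ (DeRham E X) := inferInstanceAs (Module ℝ (⨁ k : ℕ, DiffForm E X k))

variable (E X) in
/-- The inclusion of the homogeneous forms of degree `k` into `Ω(X)`. -/
def homogeneous (k : ℕ) : DiffForm E X k →ₗ[ℝ] DeRham E X :=
  DirectSum.lof ℝ ℕ (fun k => DiffForm E X k) k

variable (E X) in
/-- The component of degree `k` of a form. -/
def component (k : ℕ) : DeRham E X →ₗ[ℝ] DiffForm E X k :=
  DirectSum.component ℝ ℕ (fun k => DiffForm E X k) k

variable (E X) in
/-- The exterior derivative on `Ω(X)`. -/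
def deRhamD [IsManifold 𝓘(ℝ, E) ∞ X] : DeRham E X →ₗ[ℝ] DeRham E X :=
  DirectSum.toModule ℝ ℕ _ fun k =>
    homogeneous E X (k + 1) ∘ₗ extD k

/-- Left exterior multiplication by a homogeneous form on `Ω(X)`. -/
def mulLeft {k : ℕ} (α : DiffForm E X k) : DeRham E X →ₗ[ℝ] DeRham E X :=
  DirectSum.toModule ℝ ℕ _ fun l =>
    homogeneous E X (k + l) ∘ₗ α.wedgeLeft l

/-- The twisted differential `D = d - η` on `Ω(X)`. -/
def twistedD [IsManifold 𝓘(ℝ, E) ∞ X] (η : DiffForm E X 3) : DeRham E X →ₗ[ℝ] DeRham E X :=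
  deRhamD E X - mulLeft η

variable (E X) in
/-- The filtration of `Ω(X)` by form degree: forms all of whose components have degree `≥ p`. -/
def degreeFiltration (p : ℕ) : Submodule ℝ (DeRham E X) :=
  ⨅ (k : ℕ) (_ : k < p), LinearMap.ker (component E X k)

variable (E X) in
/-- Closed forms that are homogeneous of degree `p`. -/
def closedForms [IsManifold 𝓘(ℝ, E) ∞ X] (p : ℕ) : Submodule ℝ (DeRham E X) :=
  LinearMap.range (homogeneous E X p) ⊓ LinearMap.ker (deRhamD E X)

variable (E X) in
/-- The de Rham cohomology `H^p(X; ℝ)`: closed `p`-forms modulo exact ones. -/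
abbrev deRhamH [IsManifold 𝓘(ℝ, E) ∞ X] (p : ℕ) : Type _ :=
  closedForms E X p ⧸ (LinearMap.range (deRhamD E X)).submoduleOf (closedForms E X p)

/-- The cohomology class of a closed `p`-form. -/
abbrev cohomologyClass [IsManifold 𝓘(ℝ, E) ∞ X] {p : ℕ} (x : closedForms E X p) :
    deRhamH E X p :=
  Submodule.Quotient.mk x

end Forms

/-! ### The spectral sequence of a filtered differential module -/

namespace FilteredModule

variable {M : Type*} [AddCommGroup M] [Module ℝ M]

/-- `Z_r^p = {x ∈ F^p | D x ∈ F^{p+r}}`. -/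
def cycles (D : M →ₗ[ℝ] M) (F : ℕ → Submodule ℝ M) (r p : ℕ) : Submodule ℝ M :=
  F p ⊓ (F (p + r)).comap D

/-- `F^{p+1} + D F^{p-r+1}`. The filtration is indexed by `ℕ`, with `F^0` the whole module, and
`F^q` stands for `F^0` when `q < 0`, in accordance with truncated subtraction. -/
def boundaries (D : M →ₗ[ℝ] M) (F : ℕ → Submodule ℝ M) (r p : ℕ) : Submodule ℝ M :=
  F (p + 1) ⊔ (F (p + 1 - r)).map D

/-- The term `E_r^p = Z_r^p / (Z_r^p ∩ (F^{p+1} + D F^{p-r+1}))` of the spectral sequence. -/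
abbrev Page (D : M →ₗ[ℝ] M) (F : ℕ → Submodule ℝ M) (r p : ℕ) : Type _ :=
  cycles D F r p ⧸ (boundaries D F r p).submoduleOf (cycles D F r p)

/-- The class in `E_r^p` of an element of `Z_r^p`. -/
abbrev pageClass {D : M →ₗ[ℝ] M} {F : ℕ → Submodule ℝ M} {r p : ℕ} (z : cycles D F r p) :
    Page D F r p :=
  Submodule.Quotient.mk z

/-- The differential `d_r : E_r^p → E_r^{p+r}` of the spectral sequence, induced by `D`. -/
def pageD {D : M →ₗ[ℝ] M} (hD : ∀ x, D (D x) = 0) (F : ℕ → Submodule ℝ M) (r p : ℕ) :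
    Page D F r p →ₗ[ℝ] Page D F r (p + r) :=
  Submodule.mapQ _ _
    (D.restrict (p := cycles D F r p) (q := cycles D F r (p + r)) fun x hx =>
      ⟨hx.2, by
        change D (D x) ∈ F (p + r + r)
        rw [hD]
        exact zero_mem _⟩) <| by
    rintro ⟨x, hx⟩ h
    obtain ⟨a, ha, b, ⟨y, -, rfl⟩, hab⟩ := Submodule.mem_sup.1 (Submodule.mem_comap.1 h)
    have hab' : a + D y = x := hab
    refine Submodule.mem_comap.2 (Submodule.mem_comap.2 (Submodule.mem_sup_right ⟨a, ?_, ?_⟩))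
    · rwa [show p + r + 1 - r = p + 1 by omega]
    · change D a = D x
      rw [← hab', map_add, hD, add_zero]

end FilteredModule

/-! ### Comparison with cohomology and iterated Massey products -/

section Massey

variable {E : Type*} [NormedAddCommGroup E] [NormedSpace ℝ E]
  {X : Type*} [TopologicalSpace X] [ChartedSpace E X] [IsManifold 𝓘(ℝ, E) ∞ X]

/-- The term `E_r^p` of the spectral sequence of `(Ω(X), d - η)` filtered by form degree. -/
abbrev TwistedPage (η : DiffForm E X 3) (r p : ℕ) : Type _ :=
  FilteredModule.Page (twistedD η) (degreeFiltration E X) r p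

/-- The element `u ∈ E_r^p` is represented by the cohomology class `c ∈ H^p(X)`: some
`z = x + (terms of degree > p)` in `Z_r^p` has class `u`, where `x` is a closed `p`-form
with class `c`. -/
def IsRepresentedBy {η : DiffForm E X 3} {r p : ℕ} (u : TwistedPage η r p)
    (c : deRhamH E X p) : Prop :=
  ∃ (x : closedForms E X p)
    (z : FilteredModule.cycles (twistedD η) (degreeFiltration E X) r p),
    cohomologyClass x = c ∧ FilteredModule.pageClass z = u ∧
      (z : DeRham E X) - x ∈ degreeFiltration E X (p + 1)

/-- The iterated Massey product `{η, …, η, c}` with `m + 1` entries `η`, as the set of all its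
values in `H^{p+2m+3}(X)`. A value is the class of `η ∧ a_m`, where `a_j` is a form of
degree `p + 2j` for `j ≤ m`, `a_0` is a closed form with class `c`, and
`d a_{j+1} = η ∧ a_j` for `j < m`. The product is defined if this set is non-empty.
For `m = 0` it is the product `[η] c`. -/
def masseyProduct (η : DiffForm E X 3) (m : ℕ) {p : ℕ} (c : deRhamH E X p) :
    Set (deRhamH E X (p + (2 * m + 3))) :=
  {μ | ∃ (a : ∀ j : ℕ, DiffForm E X (p + 2 * j)) (x : closedForms E X p)
      (w : closedForms E X (p + (2 * m + 3))),
    (x : DeRham E X) = (homogeneous E X _ (a 0)) ∧ cohomologyClass x = c ∧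
    (∀ j < m, deRhamD E X (homogeneous E X _ (a (j + 1))) = mulLeft η (homogeneous E X _ (a j))) ∧
    (w : DeRham E X) = mulLeft η (homogeneous E X _ (a m)) ∧ cohomologyClass w = μ}

end Massey

end

/-! The argument rests on three identities for `d` and `L = η ∧ ·` on `Ω(X)`: `d² = 0`, `dL = -Ld`
(as `η` is closed of odd degree) and `L² = 0` (as `η` has odd degree). Together they give
`(d - L)² = 0`.

The Leibniz rule and `L² = 0` are pointwise statements about exterior products of alternating forms.
Over `ℝ` the shuffle sum that defines the exterior product, and the alternatization that defines the
exterior derivative, are up to factorials alternating sums over all permutations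
(`factorial_mul_wedge`, `factorial_mul_alternatizeUncurryFin`). In an iterated alternating sum the
inner alternation can be left out (`altSum_altSum_comp`), so both statements reduce to the sign of
one permutation: a cycle for the Leibniz rule, the exchange of two blocks of length `3` for `L² = 0`.

Everything else is bookkeeping of degrees. The part of degree `p` of a cycle in `Z_r^p`, `r ≥ 2`, is
closed, and it determines the class in `E_r^p`; if it is exact, the class vanishes
(`mem_boundaries_of_exact`). For `r ≤ 3` every closed `p`-form is a cycle and conversely a boundary
has exact part of degree `p`, whence `E_2` and `E_3` are de Rham cohomology. In general, the
condition `(d - L) z ∈ F^{p+r}` says in the degrees `p + 1, p + 3, …` that the parts `a_j` of `z` in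
the degrees `p + 2j` form a defining system of a Massey product, `d a_0 = 0` and
`d a_{j+1} = L a_j`. For such a system the sum telescopes, `(d - L) (∑_{j ≤ m} a_j) = -L a_m`
(`twistedD_sum_range`). As `L a_m` has degree `p + 2m + 3`, this describes `d_{2m+3}` as the negative
of the Massey product. For `r = 2m + 2`, the difference of `z` and `∑_{j ≤ m} a_j` lies in `F^{p+1}`,
so that `(d - L) z` lies in `F^{p+r+1}` up to a boundary, and `d_r = 0`. -/

noncomputable section

/-! ### Alternating sums over permutations -/

namespace AlternatingForm

section AltSum

variable {V ι κ : Type*} [Fintype ι] [DecidableEq ι] [Fintype κ] [DecidableEq κ]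

/-- The alternating sum `∑ σ, sign σ * f (v ∘ σ)` of a function `f` of a family of vectors, over
all permutations of the index type, without a normalizing factor. -/
def altSum (f : (ι → V) → ℝ) (v : ι → V) : ℝ :=
  ∑ σ : Equiv.Perm ι, ((Equiv.Perm.sign σ : ℤ) : ℝ) * f (v ∘ σ)

theorem altSum_comp_perm (f : (ι → V) → ℝ) (π : Equiv.Perm ι) (v : ι → V) :
    altSum (fun w => f (w ∘ π)) v = ((Equiv.Perm.sign π : ℤ) : ℝ) * altSum f v := by
  unfold altSum
  rw [Finset.mul_sum, ← Equiv.sum_comp (Equiv.mulRight π)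
    (fun σ => ((Equiv.Perm.sign π : ℤ) : ℝ) * (((Equiv.Perm.sign σ : ℤ) : ℝ) * f (v ∘ σ)))]
  refine Finset.sum_congr rfl fun σ _ => ?_
  have h : ((Equiv.Perm.sign π : ℤ) : ℝ) * ((Equiv.Perm.sign π : ℤ) : ℝ) = 1 := by
    rcases Int.units_eq_one_or (Equiv.Perm.sign π) with h | h <;> simp [h]
  rw [Equiv.coe_mulRight, Equiv.Perm.sign_mul, Units.val_mul, Int.cast_mul]
  change ((Equiv.Perm.sign σ : ℤ) : ℝ) * f ((v ∘ σ) ∘ π) = _ * (_ * f ((v ∘ σ) ∘ π))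
  linear_combination (-((Equiv.Perm.sign σ : ℤ) : ℝ) * f ((v ∘ σ) ∘ π)) * h

theorem altSum_const_mul (c : ℝ) (f : (ι → V) → ℝ) (v : ι → V) :
    altSum (fun w => c * f w) v = c * altSum f v := by
  simp only [altSum, Finset.mul_sum, mul_left_comm]

theorem altSum_sum {S : Type*} (s : Finset S) (f : S → (ι → V) → ℝ) (v : ι → V) :
    altSum (fun w => ∑ i ∈ s, f i w) v = ∑ i ∈ s, altSum (f i) v := by
  simp only [altSum, Finset.mul_sum]
  exact Finset.sum_comm

/-- Alternating first over the permutations of a subset of the indices only multiplies the full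
alternating sum by the number of these permutations. -/
theorem altSum_altSum_embedding (φ : κ ↪ ι) (f : (ι → V) → ℝ) (v : ι → V) :
    altSum (fun w => ∑ τ : Equiv.Perm κ,
      ((Equiv.Perm.sign τ : ℤ) : ℝ) * f (w ∘ τ.viaFintypeEmbedding φ)) v =
      ((Fintype.card κ).factorial : ℝ) * altSum f v := by
  rw [altSum_sum]
  have h : ∀ τ : Equiv.Perm κ, altSum (fun w => ((Equiv.Perm.sign τ : ℤ) : ℝ) *
      f (w ∘ τ.viaFintypeEmbedding φ)) v = altSum f v := fun τ => by
    rw [altSum_const_mul, altSum_comp_perm, Equiv.Perm.viaFintypeEmbedding_sign]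
    rcases Int.units_eq_one_or (Equiv.Perm.sign τ) with h | h <;> simp [h]
  simp only [h, Finset.sum_const, Finset.card_univ, Fintype.card_perm, nsmul_eq_mul]

/-- A full alternating sum whose summand is an alternating sum `altSum (f w)` in the vectors
`w ∘ φ` is a multiple of the alternating sum of the integrand `F`, in which the inner alternation
has been left out. -/
theorem altSum_altSum_comp (φ : κ ↪ ι) (F : (ι → V) → ℝ) (f : (ι → V) → (κ → V) → ℝ)
    (hF : ∀ w (τ : Equiv.Perm κ), F (w ∘ τ.viaFintypeEmbedding φ) = f w ((w ∘ φ) ∘ τ))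
    (v : ι → V) :
    altSum (fun w => altSum (f w) (w ∘ φ)) v =
      ((Fintype.card κ).factorial : ℝ) * altSum F v := by
  rw [← altSum_altSum_embedding φ]
  simp only [hF]
  rfl

end AltSum

section Wedge

variable {V : Type*} [NormedAddCommGroup V] [NormedSpace ℝ V]

theorem altSum_alternating {n : ℕ} (α : V [⋀^Fin n]→L[ℝ] ℝ) (v : Fin n → V) :
    altSum (fun w => α w) v = (n.factorial : ℝ) * α v := by
  have h : ∀ σ : Equiv.Perm (Fin n),
      ((Equiv.Perm.sign σ : ℤ) : ℝ) * α (v ∘ σ) = α v := fun σ => by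
    have := α.toAlternatingMap.map_perm v σ
    change α (v ∘ σ) = _ • α v at this
    rw [this]
    rcases Int.units_eq_one_or (Equiv.Perm.sign σ) with h | h <;> simp [h]
  simp only [altSum, h, Finset.sum_const, Finset.card_univ, Fintype.card_perm, Fintype.card_fin,
    nsmul_eq_mul]

/-- The shuffle sum defining the exterior product, as a sum over all permutations. -/
theorem factorial_mul_wedge {k l : ℕ} (α : V [⋀^Fin k]→L[ℝ] ℝ) (β : V [⋀^Fin l]→L[ℝ] ℝ)
    (v : Fin (k + l) → V) :
    ((k.factorial : ℝ) * l.factorial) * wedge α β v =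
      altSum (fun w => α (w ∘ Fin.castAdd l) * β (w ∘ Fin.natAdd k)) v := by
  have h := congrArg (fun t => (LinearMap.mul' ℝ ℝ) (t (v ∘ finSumFinEquiv)))
    (MultilinearMap.domCoprod_alternization_eq α.toAlternatingMap β.toAlternatingMap)
  simp only [AlternatingMap.smul_apply, map_nsmul, Fintype.card_fin] at h
  rw [nsmul_eq_mul, Nat.cast_mul] at h
  refine (Eq.trans ?_ h.symm).trans ?_
  · rfl
  · rw [MultilinearMap.alternatization_apply, map_sum, altSum,
      ← (finSumFinEquiv (m := k) (n := l)).permCongr.sum_comp]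
    refine Finset.sum_congr rfl fun σ _ => ?_
    rw [Equiv.Perm.sign_permCongr, Units.smul_def, map_zsmul, zsmul_eq_mul]
    congr 1
    change α (fun i => v (finSumFinEquiv (σ (Sum.inl i)))) *
      β (fun i => v (finSumFinEquiv (σ (Sum.inr i)))) = _
    congr 2 <;> funext i <;> simp [Equiv.permCongr_apply]

open ContinuousAlternatingMap in
/-- The alternatization of a linear map into alternating forms, as a sum over all permutations. -/
theorem factorial_mul_alternatizeUncurryFin {n : ℕ} (f : V →L[ℝ] V [⋀^Fin n]→L[ℝ] ℝ)
    (v : Fin (n + 1) → V) :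
    (n.factorial : ℝ) * alternatizeUncurryFin f v =
      altSum (fun w => f (w 0) (w ∘ Fin.succ)) v := by
  have h1 := altSum_alternating (alternatizeUncurryFin f) v
  -- each summand of the alternatization is the first one, permuted by a cycle
  have h2 : ∀ w : Fin (n + 1) → V, alternatizeUncurryFin f w =
      ∑ i : Fin (n + 1), (-1 : ℝ) ^ (i : ℕ) *
        (fun u : Fin (n + 1) → V => f (u 0) (u ∘ Fin.succ)) (w ∘ i.cycleRange.symm) := by
    intro w
    rw [alternatizeUncurryFin_apply]
    refine Finset.sum_congr rfl fun i _ => ?_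
    rw [zsmul_eq_mul]
    push_cast
    congr 1
    change _ = f (w (i.cycleRange.symm 0)) _
    rw [Fin.cycleRange_symm_zero]
    congr 1
    funext j
    simp [Fin.removeNth_apply]
  simp only [h2] at h1
  rw [altSum_sum] at h1
  have h3 : ∀ i : Fin (n + 1), altSum (fun w : Fin (n + 1) → V => (-1 : ℝ) ^ (i : ℕ) *
        (fun u : Fin (n + 1) → V => f (u 0) (u ∘ Fin.succ)) (w ∘ i.cycleRange.symm)) v =
      altSum (fun w => f (w 0) (w ∘ Fin.succ)) v := by
    intro i
    rw [altSum_const_mul,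
      altSum_comp_perm (fun u : Fin (n + 1) → V => f (u 0) (u ∘ Fin.succ)), Equiv.Perm.sign_symm,
      Fin.sign_cycleRange, ← mul_assoc]
    push_cast
    rw [← pow_add, Even.neg_one_pow ⟨_, rfl⟩, one_mul]
  rw [Finset.sum_congr rfl fun i _ => h3 i, ← h2] at h1
  simp only [Finset.sum_const, Finset.card_univ, Fintype.card_fin, nsmul_eq_mul,
    Nat.factorial_succ, Nat.cast_mul] at h1
  rw [mul_assoc] at h1
  exact (mul_left_cancel₀ (by positivity) h1).symm

open ContinuousAlternatingMap in
/-- The alternatization of `x ↦ f x` when each `f x` is itself an alternating sum: the inner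
alternation can be left out. -/
theorem mul_alternatizeUncurryFin_of_altSum {n : ℕ} (f : V →L[ℝ] V [⋀^Fin n]→L[ℝ] ℝ)
    (c : ℝ) (G : V → (Fin n → V) → ℝ) (hG : ∀ x w, c * f x w = altSum (G x) w)
    (v : Fin (n + 1) → V) :
    c * alternatizeUncurryFin f v = altSum (fun w => G (w 0) (w ∘ Fin.succ)) v := by
  have h1 := factorial_mul_alternatizeUncurryFin f v
  have h2 := altSum_altSum_comp (Fin.succEmb n) (fun w : Fin (n + 1) → V => G (w 0) (w ∘ Fin.succ))
    (fun w => G (w 0)) (fun w τ => ?_) v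
  · simp only [← hG, altSum_const_mul, Fintype.card_fin] at h2
    change c * altSum (fun w => f (w 0) (w ∘ Fin.succ)) v = _ at h2
    rw [← h1, mul_left_comm] at h2
    exact mul_left_cancel₀ (by positivity) h2
  · have h0 : τ.viaFintypeEmbedding (Fin.succEmb n) 0 = 0 :=
      Equiv.Perm.viaFintypeEmbedding_apply_notMem_range _ _ (by
        rintro ⟨i, hi⟩; exact Fin.succ_ne_zero i hi)
    have hs : ∀ i, τ.viaFintypeEmbedding (Fin.succEmb n) (Fin.succ i) =
        Fin.succ (τ i) := Equiv.Perm.viaFintypeEmbedding_apply_image τ _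
    simp only [Function.comp_def, h0, hs]
    rfl

open ContinuousAlternatingMap in
/-- If the alternatization of `A` vanishes, so does that of `x ↦ A x ∧ β`. -/
theorem alternatizeUncurryFin_wedge_left {k l : ℕ} (A : V →L[ℝ] V [⋀^Fin k]→L[ℝ] ℝ)
    (hA : alternatizeUncurryFin A = 0) (β : V [⋀^Fin l]→L[ℝ] ℝ) :
    alternatizeUncurryFin ((wedgeCLM V k l).flip β ∘L A) = 0 := by
  ext v
  have h1 := mul_alternatizeUncurryFin_of_altSum ((wedgeCLM V k l).flip β ∘L A) _ _
    (fun x w => factorial_mul_wedge (A x) β w) v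
  -- alternating over the first `k + 1` arguments alone gives the alternatization of `A`
  let e : Fin (k + 1) ↪ Fin (k + l + 1) :=
    (Fin.castLEEmb (by omega : k + 1 ≤ k + l + 1))
  have h2 := altSum_altSum_comp e (fun w : Fin (k + l + 1) → V =>
      A (w 0) ((w ∘ Fin.succ) ∘ Fin.castAdd l) * β ((w ∘ Fin.succ) ∘ Fin.natAdd k))
    (fun w u => β ((w ∘ Fin.succ) ∘ Fin.natAdd k) * A (u 0) (u ∘ Fin.succ)) (fun w τ => ?_) v
  · simp only [altSum_const_mul, ← factorial_mul_alternatizeUncurryFin, hA] at h2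
    rw [← h1] at h2
    have h3 : ∀ c : ℝ, altSum (fun w : Fin (k + l + 1) → V =>
        β ((w ∘ Fin.succ) ∘ Fin.natAdd k) * (c * (0 : V [⋀^Fin (k + 1)]→L[ℝ] ℝ) (w ∘ e))) v
        = 0 := fun c => by simp [altSum]
    rw [h3] at h2
    simpa [Nat.factorial_ne_zero] using h2.symm
  · have h0 : ∀ j : Fin l, τ.viaFintypeEmbedding e (Fin.succ (Fin.natAdd k j)) =
        Fin.succ (Fin.natAdd k j) := fun j =>
      Equiv.Perm.viaFintypeEmbedding_apply_notMem_range _ _ (by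
        rintro ⟨i, hi⟩
        have := congrArg Fin.val hi
        simp [e] at this
        omega)
    have hs : ∀ i, τ.viaFintypeEmbedding e (e i) = e (τ i) :=
      Equiv.Perm.viaFintypeEmbedding_apply_image τ _
    have hs0 : τ.viaFintypeEmbedding e 0 = e (τ 0) := hs 0
    have hs1 : ∀ i : Fin k, τ.viaFintypeEmbedding e (Fin.succ (Fin.castAdd l i)) =
      e (τ (Fin.succ i)) := fun i => hs i.succ
    simp only [Function.comp_def, h0, hs0, hs1]
    rw [mul_comm]

open ContinuousAlternatingMap in
/-- Alternatization commutes with `α ∧ ·` up to the sign `(-1) ^ deg α`. -/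
theorem alternatizeUncurryFin_wedge_right {k l : ℕ} (α : V [⋀^Fin k]→L[ℝ] ℝ)
    (B : V →L[ℝ] V [⋀^Fin l]→L[ℝ] ℝ) :
    alternatizeUncurryFin (wedgeCLM V k l α ∘L B) =
      ((-1 : ℝ) ^ k • wedge α (alternatizeUncurryFin B) : V [⋀^Fin (k + (l + 1))]→L[ℝ] ℝ) := by
  ext v
  have h1 := mul_alternatizeUncurryFin_of_altSum (wedgeCLM V k l α ∘L B) _ _
    (fun x w => factorial_mul_wedge α (B x) w) v
  have h2 := factorial_mul_wedge α (alternatizeUncurryFin B) v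
  let H : (Fin (k + (l + 1)) → V) → ℝ := fun w =>
    α (w ∘ Fin.castAdd (l + 1)) * B (w (Fin.natAdd k 0)) ((w ∘ Fin.natAdd k) ∘ Fin.succ)
  have h3 := altSum_altSum_comp (Fin.natAddEmb k) H
    (fun w u => α (w ∘ Fin.castAdd (l + 1)) * B (u 0) (u ∘ Fin.succ)) (fun w τ => ?_) v
  · -- the cycle that moves the vector inserted into `B` to the front
    let π : Equiv.Perm (Fin (k + (l + 1))) := Fin.cycleRange (Fin.natAdd k 0)
    have h4 := altSum_comp_perm H π v
    have hπ : (fun w => H (w ∘ π)) = fun w : Fin (k + l + 1) → V =>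
        α ((w ∘ Fin.succ) ∘ Fin.castAdd l) * B (w 0) ((w ∘ Fin.succ) ∘ Fin.natAdd k) := by
      have e1 : ∀ i : Fin k, π (Fin.castAdd (l + 1) i) = (Fin.castAdd l i).succ := fun i => by
        refine Fin.ext ?_
        rw [Fin.coe_cycleRange_of_lt (by simp [Fin.lt_def])]
        simp
      have e2 : π (Fin.natAdd k 0) = (0 : Fin (k + l + 1)) := Fin.cycleRange_self _
      have e3 : ∀ j : Fin l, π (Fin.natAdd k j.succ) = (Fin.natAdd k j).succ := fun j => by
        refine (Fin.cycleRange_of_gt (by simp [Fin.lt_def])).trans ?_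
        refine Fin.ext ?_
        simp [add_assoc]
      funext w
      simp only [H, Function.comp_def, e1, e2, e3]
    rw [hπ, ← h1, Fin.sign_cycleRange] at h4
    simp only [altSum_const_mul, ← factorial_mul_alternatizeUncurryFin, Fintype.card_fin] at h3
    have h5 : altSum (fun w : Fin (k + (l + 1)) → V => α (w ∘ Fin.castAdd (l + 1)) *
        ((l.factorial : ℝ) * alternatizeUncurryFin B (w ∘ Fin.natAdd k))) v = _ := h3
    simp only [mul_left_comm _ (l.factorial : ℝ), altSum_const_mul] at h5
    rw [← h2] at h5
    have hk : (k.factorial : ℝ) ≠ 0 := by positivity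
    have hl : (l.factorial : ℝ) ≠ 0 := by positivity
    have hl' : ((l + 1).factorial : ℝ) ≠ 0 := by positivity
    have h6 : altSum H v = (k.factorial : ℝ) * l.factorial * wedge α (alternatizeUncurryFin B) v :=
      mul_left_cancel₀ hl' (by rw [← h5]; ring)
    rw [h6] at h4
    refine mul_left_cancel₀ (mul_ne_zero hk hl) (h4.trans ?_)
    simp
    ring
  · have e1 : ∀ i : Fin k, τ.viaFintypeEmbedding (Fin.natAddEmb k)
        (Fin.castAdd (l + 1) i) = Fin.castAdd (l + 1) i := fun i =>
      Equiv.Perm.viaFintypeEmbedding_apply_notMem_range _ _ (by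
        rintro ⟨j, hj⟩
        have := congrArg Fin.val hj
        simp at this
        omega)
    have e2 : ∀ j, τ.viaFintypeEmbedding (Fin.natAddEmb k) (Fin.natAdd k j) =
        Fin.natAdd k (τ j) := Equiv.Perm.viaFintypeEmbedding_apply_image τ _
    simp only [H, Function.comp_def, e1, e2]
    rfl

/-- Multiplication by a `3`-form squares to zero. -/
theorem wedge_wedge_self {l : ℕ} (α : V [⋀^Fin 3]→L[ℝ] ℝ) (β : V [⋀^Fin l]→L[ℝ] ℝ) :
    wedge α (wedge α β) = 0 := by
  ext v
  have h1 := factorial_mul_wedge α (wedge α β) v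
  let H : (Fin (3 + (3 + l)) → V) → ℝ := fun w =>
    α (w ∘ Fin.castAdd (3 + l)) *
      (α ((w ∘ Fin.natAdd 3) ∘ Fin.castAdd l) * β ((w ∘ Fin.natAdd 3) ∘ Fin.natAdd 3))
  have h2 := altSum_altSum_comp (Fin.natAddEmb 3) H
    (fun w u => α (w ∘ Fin.castAdd (3 + l)) * (α (u ∘ Fin.castAdd l) * β (u ∘ Fin.natAdd 3)))
    (fun w τ => ?_) v
  · -- exchanging the arguments of the two factors `α` is an odd permutation
    let e : Fin 6 ↪ Fin (3 + (3 + l)) :=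
      (Fin.castLEEmb (by omega : 6 ≤ 3 + (3 + l)))
    let σ : Equiv.Perm (Fin 6) := Equiv.swap 0 3 * Equiv.swap 1 4 * Equiv.swap 2 5
    let π : Equiv.Perm (Fin (3 + (3 + l))) := σ.viaFintypeEmbedding e
    have hσ : Equiv.Perm.sign σ = -1 := by decide
    have h3 := altSum_comp_perm H π v
    have hπ : (fun w => H (w ∘ π)) = H := by
      have hs : ∀ i, π (e i) = e (σ i) := Equiv.Perm.viaFintypeEmbedding_apply_image σ _
      have e1 : ∀ i : Fin 3, π (Fin.castAdd (3 + l) i) = Fin.natAdd 3 (Fin.castAdd l i) := by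
        intro i
        fin_cases i
        exacts [hs 0, hs 1, hs 2]
      have e2 : ∀ i : Fin 3, π (Fin.natAdd 3 (Fin.castAdd l i)) = Fin.castAdd (3 + l) i := by
        intro i
        fin_cases i
        exacts [hs 3, hs 4, hs 5]
      have e3 : ∀ j : Fin l, π (Fin.natAdd 3 (Fin.natAdd 3 j)) = Fin.natAdd 3 (Fin.natAdd 3 j) :=
        fun j => Equiv.Perm.viaFintypeEmbedding_apply_notMem_range _ _ (by
          rintro ⟨i, hi⟩
          have := congrArg Fin.val hi
          simp [e] at this
          omega)
      funext w
      simp only [H, Function.comp_def, e1, e2, e3]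
      ring
    rw [hπ, Equiv.Perm.viaFintypeEmbedding_sign, hσ] at h3
    have h4 : altSum H v = 0 := by
      push_cast at h3
      linarith
    rw [h4, mul_zero] at h2
    simp only [altSum_const_mul, ← factorial_mul_wedge] at h2
    have h5 : altSum (fun w : Fin (3 + (3 + l)) → V => α (w ∘ Fin.castAdd (3 + l)) *
        (((3 : ℕ).factorial : ℝ) * l.factorial * wedge α β (w ∘ Fin.natAdd 3))) v = 0 := h2
    simp only [mul_left_comm _ (((3 : ℕ).factorial : ℝ) * l.factorial), altSum_const_mul] at h5
    rw [← h1] at h5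
    simpa [Nat.factorial_ne_zero] using h5
  · have e1 : ∀ i : Fin 3, τ.viaFintypeEmbedding (Fin.natAddEmb 3)
        (Fin.castAdd (3 + l) i) = Fin.castAdd (3 + l) i := fun i =>
      Equiv.Perm.viaFintypeEmbedding_apply_notMem_range _ _ (by
        rintro ⟨j, hj⟩
        have := congrArg Fin.val hj
        simp at this
        omega)
    have e2 : ∀ j, τ.viaFintypeEmbedding (Fin.natAddEmb 3) (Fin.natAdd 3 j) =
        Fin.natAdd 3 (τ j) := Equiv.Perm.viaFintypeEmbedding_apply_image τ _
    simp only [H, Function.comp_def, e1, e2]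
    rfl

end Wedge
end AlternatingForm

/-! ### Closed forms and the exterior product -/

namespace AlternatingForm

variable {V : Type*} [NormedAddCommGroup V] [NormedSpace ℝ V]

/-- The Leibniz rule `d (α ∧ β) = (-1) ^ deg α • α ∧ d β` for forms on a normed space, at a point
where `d α` vanishes. -/
theorem extDeriv_wedge_of_extDeriv_eq_zero {k l : ℕ} {α : V → V [⋀^Fin k]→L[ℝ] ℝ}
    {β : V → V [⋀^Fin l]→L[ℝ] ℝ} {y : V} (hα : DifferentiableAt ℝ α y)
    (hβ : DifferentiableAt ℝ β y) (h0 : extDeriv α y = 0) :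
    extDeriv (fun z => wedge (α z) (β z)) y =
      ((-1 : ℝ) ^ k • wedge (α y) (extDeriv β y) : V [⋀^Fin (k + (l + 1))]→L[ℝ] ℝ) := by
  have h1 : fderiv ℝ (fun z => wedge (α z) (β z)) y =
      wedgeCLM V k l (α y) ∘L fderiv ℝ β y + (wedgeCLM V k l).flip (β y) ∘L fderiv ℝ α y :=
    (wedgeCLM V k l).fderiv_of_bilinear hα hβ
  rw [extDeriv, h1, ContinuousAlternatingMap.alternatizeUncurryFin_add,
    alternatizeUncurryFin_wedge_left _ h0, add_zero]
  exact alternatizeUncurryFin_wedge_right _ _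

end AlternatingForm

section Forms

variable {E : Type*} [NormedAddCommGroup E] [NormedSpace ℝ E]
  {X : Type*} [TopologicalSpace X] [ChartedSpace E X]

theorem DiffForm.differentiableAt_formInChart {k : ℕ} (θ : DiffForm E X k) (x : X) :
    DifferentiableAt ℝ (formInChart θ.1 (chartAt E x)) (chartAt E x x) :=
  ((θ.2 _ (chart_mem_atlas E x)).contDiffAt
    ((chartAt E x).open_target.mem_nhds (mem_chart_target E x))).differentiableAt (by norm_num)

theorem DiffForm.wedge_wedge_self {l : ℕ} (α : DiffForm E X 3) (β : DiffForm E X l) :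
    α.wedge (α.wedge β) = 0 :=
  Subtype.ext <| funext fun x =>
    AlternatingForm.wedge_wedge_self (V := E) (α.1 x) (β.1 x)

variable [IsManifold 𝓘(ℝ, E) ∞ X]

/-- A field of forms is recovered from its expression in the preferred chart. -/
theorem formInChart_chartAt_comp {k : ℕ} (θ : ∀ x : X, TangentSpace 𝓘(ℝ, E) x [⋀^Fin k]→L[ℝ] ℝ)
    (x : X) :
    (formInChart θ (chartAt E x) (chartAt E x x)).compContinuousLinearMap
      (mfderiv 𝓘(ℝ, E) 𝓘(ℝ, E) (chartAt E x) x : TangentSpace 𝓘(ℝ, E) x →L[ℝ] E) = θ x := by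
  have : IsManifold 𝓘(ℝ, E) 1 X := IsManifold.of_le (n := ∞) (by norm_num)
  have h := (mdifferentiable_of_mem_atlas (I := 𝓘(ℝ, E)) (chart_mem_atlas E x)).symm_comp_deriv
    (mem_chart_source E x)
  have hp : ∀ p q : X, p = q → ∀ w : Fin k → E,
      (θ p : E [⋀^Fin k]→L[ℝ] ℝ) w = (θ q : E [⋀^Fin k]→L[ℝ] ℝ) w := by
    rintro p _ rfl w; rfl
  ext v
  refine (hp _ x ((chartAt E x).left_inv (mem_chart_source E x)) _).trans ?_
  refine congrArg (θ x : E [⋀^Fin k]→L[ℝ] ℝ) (funext fun i => ?_)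
  exact congrArg (fun t : E →L[ℝ] E => t (v i)) h

theorem extD_extD {k : ℕ} (θ : DiffForm E X k) : extD (k + 1) (extD k θ) = 0 := by
  refine Subtype.ext (funext fun x => ?_)
  have hmem := (chartAt E x).open_target.mem_nhds (mem_chart_target E x)
  have hev : formInChart (extD k θ).1 (chartAt E x) =ᶠ[𝓝 (chartAt E x x)]
      extDeriv (formInChart θ.1 (chartAt E x)) := by
    filter_upwards [hmem] with y hy
    exact formInChart_extDAt θ (chart_mem_atlas E x) hy
  have h2le : minSmoothness ℝ 2 ≤ (∞ : WithTop ℕ∞) := by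
    rw [minSmoothness_of_isRCLikeNormedField]
    exact WithTop.coe_le_coe.2 (le_top : (2 : ℕ∞) ≤ ⊤)
  have h : extDeriv (formInChart (extD k θ).1 (chartAt E x)) (chartAt E x x) = 0 := by
    rw [hev.extDeriv_eq]
    exact extDeriv_extDeriv_apply ((θ.2 _ (chart_mem_atlas E x)).contDiffAt hmem) h2le
  exact congrArg (fun t : E [⋀^Fin (k + 1 + 1)]→L[ℝ] ℝ => t.compContinuousLinearMap
      (mfderiv 𝓘(ℝ, E) 𝓘(ℝ, E) (chartAt E x) x : TangentSpace 𝓘(ℝ, E) x →L[ℝ] E)) h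

/-- The Leibniz rule `d (α ∧ β) = (-1) ^ deg α • α ∧ d β` for a closed form `α`. -/
theorem extD_wedge_of_closed {k l : ℕ} {α : DiffForm E X k} (hα : extD k α = 0)
    (β : DiffForm E X l) :
    extD (k + l) (α.wedge β) =
      ((-1 : ℝ) ^ k • α.wedge (extD l β) : DiffForm E X (k + (l + 1))) := by
  refine Subtype.ext (funext fun x => ?_)
  have h0 : extDeriv (formInChart α.1 (chartAt E x)) (chartAt E x x) = 0 := by
    rw [← formInChart_extDAt α (chart_mem_atlas E x) (mem_chart_target E x)]
    exact congrArg (fun t : DiffForm E X (k + 1) =>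
      formInChart t.1 (chartAt E x) (chartAt E x x)) hα
  have h1 : formInChart (α.wedge β).1 (chartAt E x) = fun y => AlternatingForm.wedge
      (formInChart α.1 (chartAt E x) y) (formInChart β.1 (chartAt E x) y) :=
    funext fun y => AlternatingForm.wedge_comp _ _ _
  have h2 := AlternatingForm.extDeriv_wedge_of_extDeriv_eq_zero
    (α.differentiableAt_formInChart x) (β.differentiableAt_formInChart x) h0
  rw [← h1] at h2
  refine (congrArg (fun t : E [⋀^Fin (k + (l + 1))]→L[ℝ] ℝ => t.compContinuousLinearMap
      (mfderiv 𝓘(ℝ, E) 𝓘(ℝ, E) (chartAt E x) x : TangentSpace 𝓘(ℝ, E) x →L[ℝ] E)) h2).trans ?_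
  refine congrArg (fun t : E [⋀^Fin (k + (l + 1))]→L[ℝ] ℝ => (-1 : ℝ) ^ k • t)
    ((AlternatingForm.wedge_comp (V := E) (W := E) _ _ _).trans ?_)
  exact congrArg (fun t : E [⋀^Fin k]→L[ℝ] ℝ => AlternatingForm.wedge t (extDAt β.1 x))
    (formInChart_chartAt_comp α.1 x)

end Forms

/-! ### Homogeneous components -/

section Components

variable {E : Type*} [NormedAddCommGroup E] [NormedSpace ℝ E]
  {X : Type*} [TopologicalSpace X] [ChartedSpace E X]

/-- Linear maps out of `Ω(X)` are determined by their values on homogeneous forms. -/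
theorem DeRham.hom_ext {N : Type*} [AddCommGroup N] [Module ℝ N] {f g : DeRham E X →ₗ[ℝ] N}
    (h : ∀ k θ, f (homogeneous E X k θ) = g (homogeneous E X k θ)) : f = g :=
  DirectSum.linearMap_ext ℝ fun k => LinearMap.ext (h k)

variable (E X) in
/-- The projection of `Ω(X)` onto the forms of degree `k`, as an endomorphism of `Ω(X)`. -/
def degreePart (k : ℕ) : DeRham E X →ₗ[ℝ] DeRham E X :=
  homogeneous E X k ∘ₗ component E X k

theorem component_homogeneous_self (k : ℕ) (θ : DiffForm E X k) :
    component E X k (homogeneous E X k θ) = θ :=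
  DirectSum.component.lof_self ℝ k θ

theorem component_homogeneous_of_ne {k l : ℕ} (h : l ≠ k) (θ : DiffForm E X k) :
    component E X l (homogeneous E X k θ) = 0 :=
  DFinsupp.single_eq_of_ne h

theorem degreePart_homogeneous_self (k : ℕ) (θ : DiffForm E X k) :
    degreePart E X k (homogeneous E X k θ) = homogeneous E X k θ :=
  congrArg (homogeneous E X k) (component_homogeneous_self k θ)

theorem degreePart_homogeneous_of_ne {k l : ℕ} (h : l ≠ k) (θ : DiffForm E X k) :
    degreePart E X l (homogeneous E X k θ) = 0 :=
  (congrArg (homogeneous E X l) (component_homogeneous_of_ne h θ)).trans (map_zero _)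

theorem degreePart_degreePart_self (k : ℕ) (x : DeRham E X) :
    degreePart E X k (degreePart E X k x) = degreePart E X k x :=
  degreePart_homogeneous_self k _

theorem degreePart_degreePart_of_ne {k l : ℕ} (h : l ≠ k) (x : DeRham E X) :
    degreePart E X l (degreePart E X k x) = 0 :=
  degreePart_homogeneous_of_ne h _

theorem mem_range_homogeneous {k : ℕ} {x : DeRham E X} :
    x ∈ LinearMap.range (homogeneous E X k) ↔ degreePart E X k x = x :=
  ⟨by rintro ⟨θ, rfl⟩; exact degreePart_homogeneous_self k θ, fun h => ⟨_, h⟩⟩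

theorem mem_degreeFiltration {p : ℕ} {x : DeRham E X} :
    x ∈ degreeFiltration E X p ↔ ∀ k < p, degreePart E X k x = 0 := by
  simp only [degreeFiltration, Submodule.mem_iInf, LinearMap.mem_ker]
  refine forall₂_congr fun k _ =>
    ⟨fun h => (congrArg (homogeneous E X k) h).trans (map_zero _), fun h => ?_⟩
  have := congrArg (component E X k) h
  rw [map_zero] at this
  exact (component_homogeneous_self k _).symm.trans this

theorem degreeFiltration_antitone : Antitone (degreeFiltration E X) := fun _ _ h _ hx =>
  mem_degreeFiltration.2 fun k hk => mem_degreeFiltration.1 hx k (hk.trans_le h)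

theorem degreePart_mem_degreeFiltration {p k : ℕ} (h : p ≤ k) (x : DeRham E X) :
    degreePart E X k x ∈ degreeFiltration E X p :=
  mem_degreeFiltration.2 fun l hl => degreePart_degreePart_of_ne (by omega) x

theorem mem_degreeFiltration_of_degreePart_eq {p : ℕ} {x : DeRham E X}
    (h : degreePart E X p x = x) : x ∈ degreeFiltration E X p :=
  h ▸ degreePart_mem_degreeFiltration le_rfl x

/-- Elements of `F^p` with the same part of degree `p` agree modulo `F^{p+1}`. -/
theorem sub_mem_degreeFiltration_succ {p : ℕ} {x y : DeRham E X}
    (hx : x ∈ degreeFiltration E X p) (hy : y ∈ degreeFiltration E X p) :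
    x - y ∈ degreeFiltration E X (p + 1) ↔ degreePart E X p x = degreePart E X p y := by
  rw [mem_degreeFiltration, ← sub_eq_zero, ← map_sub]
  refine ⟨fun h => h p (by omega), fun h k hk => ?_⟩
  rcases Nat.lt_succ_iff_lt_or_eq.1 hk with hk | rfl
  · exact mem_degreeFiltration.1 (sub_mem hx hy) k hk
  · exact h

theorem mulLeft_homogeneous {k : ℕ} (α : DiffForm E X k) (l : ℕ) (θ : DiffForm E X l) :
    mulLeft α (homogeneous E X l θ) = homogeneous E X (k + l) (α.wedge θ) :=
  DirectSum.toModule_lof _ _ _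

theorem degreePart_mulLeft (η : DiffForm E X 3) (k : ℕ) (x : DeRham E X) :
    degreePart E X (k + 3) (mulLeft η x) = mulLeft η (degreePart E X k x) := by
  have h : degreePart E X (k + 3) ∘ₗ mulLeft η = mulLeft η ∘ₗ degreePart E X k := by
    refine DeRham.hom_ext fun l θ => ?_
    rw [LinearMap.comp_apply, LinearMap.comp_apply, mulLeft_homogeneous]
    by_cases hl : k = l
    · subst hl
      rw [degreePart_homogeneous_self, mulLeft_homogeneous, add_comm k 3,
        degreePart_homogeneous_self]
    · rw [degreePart_homogeneous_of_ne hl, map_zero, degreePart_homogeneous_of_ne (by omega)]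
  exact LinearMap.congr_fun h x

theorem degreePart_mulLeft_of_lt (η : DiffForm E X 3) {k : ℕ} (hk : k < 3) (x : DeRham E X) :
    degreePart E X k (mulLeft η x) = 0 := by
  have h : degreePart E X k ∘ₗ mulLeft η = 0 := by
    refine DeRham.hom_ext fun l θ => ?_
    rw [LinearMap.comp_apply, mulLeft_homogeneous, degreePart_homogeneous_of_ne (by omega),
      LinearMap.zero_apply]
  exact LinearMap.congr_fun h x

/-- `η ∧ (η ∧ x) = 0`, as `η` has odd degree. -/
theorem mulLeft_mulLeft_self (η : DiffForm E X 3) (x : DeRham E X) :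
    mulLeft η (mulLeft η x) = 0 := by
  have h : mulLeft η ∘ₗ mulLeft η = 0 := by
    refine DeRham.hom_ext fun l θ => ?_
    rw [LinearMap.comp_apply, mulLeft_homogeneous, mulLeft_homogeneous,
      DiffForm.wedge_wedge_self, map_zero, LinearMap.zero_apply]
  exact LinearMap.congr_fun h x

theorem mulLeft_mem_degreeFiltration (η : DiffForm E X 3) {p : ℕ} {x : DeRham E X}
    (hx : x ∈ degreeFiltration E X p) : mulLeft η x ∈ degreeFiltration E X (p + 3) := by
  refine mem_degreeFiltration.2 fun k hk => ?_
  rcases lt_or_ge k 3 with h | h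
  · exact degreePart_mulLeft_of_lt η h x
  · obtain ⟨l, rfl⟩ := Nat.exists_eq_add_of_le' h
    rw [degreePart_mulLeft, mem_degreeFiltration.1 hx l (by omega), map_zero]

theorem sum_range_sub_mem_degreeFiltration {p : ℕ} (a : ℕ → DeRham E X) (m : ℕ)
    (ha : ∀ j, a j ∈ degreeFiltration E X (p + 2 * j)) :
    ∑ j ∈ Finset.range (m + 1), a j - a 0 ∈ degreeFiltration E X (p + 1) := by
  rw [Finset.sum_range_succ', add_sub_cancel_right]
  exact sum_mem fun j _ => degreeFiltration_antitone (by omega) (ha (j + 1))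

variable [IsManifold 𝓘(ℝ, E) ∞ X]

theorem deRhamD_homogeneous (k : ℕ) (θ : DiffForm E X k) :
    deRhamD E X (homogeneous E X k θ) = homogeneous E X (k + 1) (extD k θ) :=
  DirectSum.toModule_lof _ _ _

theorem degreePart_deRhamD (k : ℕ) (x : DeRham E X) :
    degreePart E X (k + 1) (deRhamD E X x) = deRhamD E X (degreePart E X k x) := by
  have h : degreePart E X (k + 1) ∘ₗ deRhamD E X = deRhamD E X ∘ₗ degreePart E X k := by
    refine DeRham.hom_ext fun l θ => ?_
    rw [LinearMap.comp_apply, LinearMap.comp_apply, deRhamD_homogeneous]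
    by_cases hl : k = l
    · subst hl
      rw [degreePart_homogeneous_self, degreePart_homogeneous_self, deRhamD_homogeneous]
    · rw [degreePart_homogeneous_of_ne hl, map_zero, degreePart_homogeneous_of_ne (by omega)]
  exact LinearMap.congr_fun h x

theorem degreePart_zero_deRhamD (x : DeRham E X) : degreePart E X 0 (deRhamD E X x) = 0 := by
  have h : degreePart E X 0 ∘ₗ deRhamD E X = 0 := by
    refine DeRham.hom_ext fun l θ => ?_
    rw [LinearMap.comp_apply, deRhamD_homogeneous, degreePart_homogeneous_of_ne (by omega),
      LinearMap.zero_apply]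
  exact LinearMap.congr_fun h x

theorem deRhamD_deRhamD (x : DeRham E X) : deRhamD E X (deRhamD E X x) = 0 := by
  have h : deRhamD E X ∘ₗ deRhamD E X = 0 := by
    refine DeRham.hom_ext fun l θ => ?_
    rw [LinearMap.comp_apply, deRhamD_homogeneous, deRhamD_homogeneous, extD_extD, map_zero,
      LinearMap.zero_apply]
  exact LinearMap.congr_fun h x

/-- The exterior derivative anticommutes with multiplication by a closed `3`-form. -/
theorem deRhamD_mulLeft {η : DiffForm E X 3} (hη : extD 3 η = 0) (x : DeRham E X) :
    deRhamD E X (mulLeft η x) = -mulLeft η (deRhamD E X x) := by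
  have h : deRhamD E X ∘ₗ mulLeft η = -(mulLeft η ∘ₗ deRhamD E X) := by
    refine DeRham.hom_ext fun l θ => ?_
    have h2 : extD (3 + l) (η.wedge θ) = (-η.wedge (extD l θ) : DiffForm E X (3 + (l + 1))) := by
      rw [extD_wedge_of_closed hη, show (-1 : ℝ) ^ 3 = -1 by norm_num, neg_one_smul]
    rw [LinearMap.comp_apply, LinearMap.neg_apply, LinearMap.comp_apply, deRhamD_homogeneous,
      mulLeft_homogeneous, mulLeft_homogeneous, deRhamD_homogeneous, h2]
    exact map_neg (homogeneous E X (3 + (l + 1))) _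
  exact LinearMap.congr_fun h x

theorem twistedD_apply (η : DiffForm E X 3) (x : DeRham E X) :
    twistedD η x = deRhamD E X x - mulLeft η x := rfl

theorem twistedD_twistedD {η : DiffForm E X 3} (hη : extD 3 η = 0) (x : DeRham E X) :
    twistedD η (twistedD η x) = 0 := by
  simp only [twistedD_apply, map_sub, deRhamD_deRhamD, deRhamD_mulLeft hη, mulLeft_mulLeft_self]
  abel

theorem deRhamD_mem_degreeFiltration {p : ℕ} {x : DeRham E X}
    (hx : x ∈ degreeFiltration E X p) : deRhamD E X x ∈ degreeFiltration E X (p + 1) := by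
  refine mem_degreeFiltration.2 fun k hk => ?_
  cases k with
  | zero => exact degreePart_zero_deRhamD x
  | succ l => rw [degreePart_deRhamD, mem_degreeFiltration.1 hx l (by omega), map_zero]

theorem twistedD_mem_degreeFiltration (η : DiffForm E X 3) {p : ℕ} {x : DeRham E X}
    (hx : x ∈ degreeFiltration E X p) : twistedD η x ∈ degreeFiltration E X (p + 1) :=
  sub_mem (deRhamD_mem_degreeFiltration hx)
    (degreeFiltration_antitone (by omega) (mulLeft_mem_degreeFiltration η hx))

theorem mem_closedForms {p : ℕ} {x : DeRham E X} :
    x ∈ closedForms E X p ↔ degreePart E X p x = x ∧ deRhamD E X x = 0 :=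
  and_congr mem_range_homogeneous LinearMap.mem_ker

end Components

/-! ### Representatives in the spectral sequence -/

section SpectralSequence

open FilteredModule

variable {E : Type*} [NormedAddCommGroup E] [NormedSpace ℝ E]
  {X : Type*} [TopologicalSpace X] [ChartedSpace E X] [IsManifold 𝓘(ℝ, E) ∞ X]

/-- This is the condition `D z ∈ F^{p+r}` in degree `p + 1`, which `η ∧ z` does not reach. -/
theorem degreePart_mem_closedForms (η : DiffForm E X 3) {r p : ℕ} (hr : 2 ≤ r) {z : DeRham E X}
    (hz : z ∈ cycles (twistedD η) (degreeFiltration E X) r p) :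
    degreePart E X p z ∈ closedForms E X p := by
  refine mem_closedForms.2 ⟨degreePart_degreePart_self p z, ?_⟩
  have h := mem_degreeFiltration.1 hz.2 (p + 1) (by omega)
  rwa [twistedD_apply, map_sub, mem_degreeFiltration.1 (mulLeft_mem_degreeFiltration η hz.1)
    (p + 1) (by omega), sub_zero, degreePart_deRhamD] at h

theorem twistedD_closedForm (η : DiffForm E X 3) {p : ℕ} (x : closedForms E X p) :
    twistedD η x = -mulLeft η x := by
  rw [twistedD_apply, (mem_closedForms.1 x.2).2, zero_sub]

theorem closedForm_mem_cycles (η : DiffForm E X 3) {r p : ℕ} (hr : r ≤ 3)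
    (x : closedForms E X p) :
    (x : DeRham E X) ∈ cycles (twistedD η) (degreeFiltration E X) r p := by
  have hx := mem_degreeFiltration_of_degreePart_eq (mem_closedForms.1 x.2).1
  refine ⟨hx, ?_⟩
  change twistedD η x ∈ degreeFiltration E X (p + r)
  rw [twistedD_closedForm]
  exact neg_mem (degreeFiltration_antitone (by omega) (mulLeft_mem_degreeFiltration η hx))

theorem mulLeft_mem_closedForms {η : DiffForm E X 3} (hη : extD 3 η = 0) {p : ℕ}
    (x : closedForms E X p) : mulLeft η x ∈ closedForms E X (p + 3) := by
  refine mem_closedForms.2 ⟨?_, ?_⟩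
  · rw [degreePart_mulLeft, (mem_closedForms.1 x.2).1]
  · rw [deRhamD_mulLeft hη, (mem_closedForms.1 x.2).2, map_zero, neg_zero]

/-- An element of `F^p` with exact part of degree `p` is zero in `E_r^p`, for `r ≥ 2`. -/
theorem mem_boundaries_of_exact (η : DiffForm E X 3) {r p : ℕ} (hr : 2 ≤ r) {z : DeRham E X}
    (hz : z ∈ degreeFiltration E X p)
    (h : degreePart E X p z ∈ LinearMap.range (deRhamD E X)) :
    z ∈ boundaries (twistedD η) (degreeFiltration E X) r p := by
  obtain ⟨w, hw⟩ := h
  have hp := congrArg (degreePart E X p) hw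
  rw [degreePart_degreePart_self] at hp
  cases p with
  | zero =>
    rw [degreePart_zero_deRhamD] at hp
    refine Submodule.mem_sup_left (mem_degreeFiltration.2 fun k hk => ?_)
    obtain rfl : k = 0 := by omega
    exact hp.symm
  | succ q =>
    rw [degreePart_deRhamD] at hp
    have hq := degreePart_mem_degreeFiltration le_rfl (k := q) w
    refine Submodule.mem_sup.2 ⟨z - twistedD η (degreePart E X q w), ?_,
      twistedD η (degreePart E X q w), ⟨_, degreeFiltration_antitone (by omega) hq, rfl⟩,
      sub_add_cancel _ _⟩
    rw [sub_mem_degreeFiltration_succ hz (twistedD_mem_degreeFiltration η hq), twistedD_apply,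
      map_sub, degreePart_deRhamD, degreePart_degreePart_self,
      mem_degreeFiltration.1 (mulLeft_mem_degreeFiltration η hq) _ (by omega), sub_zero, hp]

/-- For `r ≤ 3` the term `η ∧ y` of `D y`, `y ∈ F^{p-r+1}`, does not reach degree `p`. The indices
`p < r`, where `F^{p-r+1}` is all of `Ω(X)`, need no separate treatment. -/
theorem degreePart_exact_of_mem_boundaries (η : DiffForm E X 3) {r p : ℕ} (hr : r ≤ 3)
    {z : DeRham E X} (hz : z ∈ boundaries (twistedD η) (degreeFiltration E X) r p) :
    degreePart E X p z ∈ LinearMap.range (deRhamD E X) := by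
  obtain ⟨f, hf, _, ⟨y, hy, rfl⟩, rfl⟩ := Submodule.mem_sup.1 hz
  rw [map_add, mem_degreeFiltration.1 hf p (by omega), zero_add, twistedD_apply, map_sub,
    mem_degreeFiltration.1 (mulLeft_mem_degreeFiltration η hy) p (by omega), sub_zero]
  cases p with
  | zero => rw [degreePart_zero_deRhamD]; exact zero_mem _
  | succ q => rw [degreePart_deRhamD]; exact ⟨_, rfl⟩

/-- The map `H^p(X) → E_r^p` that sends the class of a closed form to the class of the same
form, for `r` equal to `2` or `3`. -/
def cohomologyToPage (η : DiffForm E X 3) {r : ℕ} (hr : 2 ≤ r) (hr' : r ≤ 3) (p : ℕ) :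
    deRhamH E X p →ₗ[ℝ] TwistedPage η r p :=
  Submodule.mapQ _ _ (Submodule.inclusion fun x hx => closedForm_mem_cycles η hr' ⟨x, hx⟩)
    fun x hx => mem_boundaries_of_exact η hr
      (closedForm_mem_cycles η hr' x).1 (by
        change degreePart E X p (x : DeRham E X) ∈ _
        rw [(mem_closedForms.1 x.2).1]
        exact hx)

theorem cohomologyToPage_bijective (η : DiffForm E X 3) {r : ℕ} (hr : 2 ≤ r) (hr' : r ≤ 3)
    (p : ℕ) : Function.Bijective (cohomologyToPage η hr hr' p) := by
  constructor
  · rw [injective_iff_map_eq_zero]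
    intro c hc
    obtain ⟨x, rfl⟩ := Submodule.Quotient.mk_surjective _ c
    have hb : (x : DeRham E X) ∈ boundaries (twistedD η) (degreeFiltration E X) r p :=
      (Submodule.Quotient.mk_eq_zero
        ((boundaries (twistedD η) (degreeFiltration E X) r p).submoduleOf
          (cycles (twistedD η) (degreeFiltration E X) r p))).1 hc
    have h := degreePart_exact_of_mem_boundaries η hr' hb
    refine (Submodule.Quotient.mk_eq_zero _).2 ?_
    change (x : DeRham E X) ∈ LinearMap.range (deRhamD E X)
    rw [← (mem_closedForms.1 x.2).1]
    exact h
  · intro u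
    obtain ⟨z, rfl⟩ := Submodule.Quotient.mk_surjective _ u
    refine ⟨cohomologyClass ⟨_, degreePart_mem_closedForms η hr z.2⟩, ?_⟩
    refine (Submodule.Quotient.eq _).2 (Submodule.mem_sup_left ?_)
    exact (sub_mem_degreeFiltration_succ (degreePart_mem_degreeFiltration le_rfl _) z.2.1).2
      (degreePart_degreePart_self p _)

/-- For `r` equal to `2` or `3`, the page `E_r` is de Rham cohomology. -/
def cohomologyEquivPage (η : DiffForm E X 3) {r : ℕ} (hr : 2 ≤ r) (hr' : r ≤ 3) (p : ℕ) :
    deRhamH E X p ≃ₗ[ℝ] TwistedPage η r p :=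
  LinearEquiv.ofBijective _ (cohomologyToPage_bijective η hr hr' p)

theorem isRepresentedBy_cohomologyEquivPage (η : DiffForm E X 3) {r : ℕ} (hr : 2 ≤ r)
    (hr' : r ≤ 3) (p : ℕ) (c : deRhamH E X p) :
    IsRepresentedBy (cohomologyEquivPage η hr hr' p c) c := by
  obtain ⟨x, rfl⟩ := Submodule.Quotient.mk_surjective _ c
  refine ⟨x, ⟨x, closedForm_mem_cycles η hr' x⟩, rfl, rfl, ?_⟩
  rw [sub_self]
  exact zero_mem _

/-- On `E_3`, the differential is multiplication by `-η`. -/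
theorem pageD_cohomologyEquivPage {η : DiffForm E X 3}
    (hD : ∀ θ : DeRham E X, twistedD η (twistedD η θ) = 0) (p : ℕ) (x : closedForms E X p)
    (y : closedForms E X (p + 3)) (hy : (y : DeRham E X) = mulLeft η x) :
    pageD hD (degreeFiltration E X) 3 p
        (cohomologyEquivPage η (by norm_num) le_rfl p (cohomologyClass x)) =
      -cohomologyEquivPage η (by norm_num) le_rfl (p + 3) (cohomologyClass y) := by
  let z : cycles (twistedD η) (degreeFiltration E X) 3 (p + 3) :=
    ⟨y, closedForm_mem_cycles η le_rfl y⟩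
  have hz : twistedD η x = ((-z : cycles (twistedD η) (degreeFiltration E X) 3 (p + 3)) :
      DeRham E X) := by
    rw [twistedD_closedForm, ← hy]
    rfl
  have hx : twistedD η x ∈ cycles (twistedD η) (degreeFiltration E X) 3 (p + 3) :=
    hz ▸ (-z).2
  change pageClass (⟨twistedD η x, hx⟩ : cycles (twistedD η) (degreeFiltration E X) 3 (p + 3)) =
    -pageClass z
  rw [← Submodule.Quotient.mk_neg]
  exact congrArg pageClass (Subtype.ext hz)

theorem exists_isRepresentedBy {η : DiffForm E X 3} {r p : ℕ} (hr : 2 ≤ r)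
    (u : TwistedPage η r p) : ∃ c, IsRepresentedBy u c := by
  obtain ⟨z, rfl⟩ := Submodule.Quotient.mk_surjective _ u
  exact ⟨_, ⟨_, degreePart_mem_closedForms η hr z.2⟩, z, rfl, rfl,
    (sub_mem_degreeFiltration_succ z.2.1 (degreePart_mem_degreeFiltration le_rfl _)).2
      (degreePart_degreePart_self p _).symm⟩

theorem IsRepresentedBy.unique {η : DiffForm E X 3} {r p : ℕ} (hr : 2 ≤ r)
    {c : deRhamH E X p} {u u' : TwistedPage η r p}
    (h : IsRepresentedBy u c) (h' : IsRepresentedBy u' c) : u = u' := by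
  obtain ⟨x, z, rfl, rfl, hz⟩ := h
  obtain ⟨x', z', hxx', rfl, hz'⟩ := h'
  refine (Submodule.Quotient.eq _).2
    (mem_boundaries_of_exact η hr (sub_mem z.2.1 z'.2.1) ?_)
  have hx := mem_degreeFiltration_of_degreePart_eq (mem_closedForms.1 x.2).1
  have hx' := mem_degreeFiltration_of_degreePart_eq (mem_closedForms.1 x'.2).1
  change degreePart E X p ((z : DeRham E X) - z') ∈ _
  rw [map_sub, (sub_mem_degreeFiltration_succ z.2.1 hx).1 hz,
    (sub_mem_degreeFiltration_succ z'.2.1 hx').1 hz', (mem_closedForms.1 x.2).1,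
    (mem_closedForms.1 x'.2).1]
  have h := (Submodule.Quotient.eq
    ((LinearMap.range (deRhamD E X)).submoduleOf (closedForms E X p))).1 hxx'.symm
  exact h

/-! ### Defining systems of Massey products -/

/-- The sum of a defining system `d a_0 = 0`, `d a_{j+1} = η ∧ a_j` telescopes under `d - η`. -/
theorem twistedD_sum_range (η : DiffForm E X 3) (a : ℕ → DeRham E X) (m : ℕ)
    (h0 : deRhamD E X (a 0) = 0) (h : ∀ j < m, deRhamD E X (a (j + 1)) = mulLeft η (a j)) :
    twistedD η (∑ j ∈ Finset.range (m + 1), a j) = -mulLeft η (a m) := by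
  induction m with
  | zero => simp [twistedD_apply, h0]
  | succ m ih =>
    rw [Finset.sum_range_succ, map_add, ih fun j hj => h j (by omega), twistedD_apply,
      h m (by omega)]
    abel

/-- The parts of a cycle in the degrees `p, p + 2, p + 4, …` form a defining system. -/
theorem deRhamD_degreePart_of_mem_cycles (η : DiffForm E X 3) {r p j : ℕ} (hr : 2 * j + 3 < r)
    {z : DeRham E X} (hz : z ∈ cycles (twistedD η) (degreeFiltration E X) r p) :
    deRhamD E X (degreePart E X (p + 2 * (j + 1)) z) =
      mulLeft η (degreePart E X (p + 2 * j) z) := by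
  have h := mem_degreeFiltration.1 hz.2 (p + 2 * (j + 1) + 1) (by omega)
  rw [twistedD_apply, map_sub, degreePart_deRhamD] at h
  exact (sub_eq_zero.1 h).trans (degreePart_mulLeft η (p + 2 * j) z)

/-- Up to `D F^{p+1}`, the image `D z` of a cycle is that of the parts of `z` in the degrees
`p, p + 2, …`, which has no part of degree `p + 2k`, as `D` changes the parity of the degree. -/
theorem pageD_even_eq_zero {η : DiffForm E X 3}
    (hD : ∀ θ : DeRham E X, twistedD η (twistedD η θ) = 0) (k p : ℕ) :
    pageD hD (degreeFiltration E X) (2 * k) p = 0 := by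
  refine LinearMap.ext fun u => ?_
  obtain ⟨z, rfl⟩ := Submodule.Quotient.mk_surjective _ u
  refine (Submodule.Quotient.mk_eq_zero _).2 ?_
  change twistedD η z ∈ boundaries (twistedD η) (degreeFiltration E X) (2 * k) (p + 2 * k)
  cases k with
  | zero => exact Submodule.mem_sup_left (twistedD_mem_degreeFiltration η z.2.1)
  | succ m =>
    -- the part of `z` in the degrees `p, p + 2, …, p + 2m`
    set z' := ∑ j ∈ Finset.range (m + 1), degreePart E X (p + 2 * j) z with hz'
    have h1 : twistedD η z' = -mulLeft η (degreePart E X (p + 2 * m) z) :=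
      twistedD_sum_range η (fun j => degreePart E X (p + 2 * j) z) m
        (mem_closedForms.1 (degreePart_mem_closedForms η (by omega) z.2)).2
        fun j hj => deRhamD_degreePart_of_mem_cycles η (by omega) z.2
    have h2 : z' - degreePart E X p z ∈ degreeFiltration E X (p + 1) :=
      sum_range_sub_mem_degreeFiltration (fun j => degreePart E X (p + 2 * j) z) m
        fun j => degreePart_mem_degreeFiltration le_rfl _
    have h3 := (sub_mem_degreeFiltration_succ z.2.1
      (degreePart_mem_degreeFiltration le_rfl (z : DeRham E X))).2
      (degreePart_degreePart_self p (z : DeRham E X)).symm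
    have h4 : (z : DeRham E X) - z' ∈ degreeFiltration E X (p + 1) := by
      have := sub_mem h3 h2
      rwa [sub_sub_sub_cancel_right] at this
    refine Submodule.mem_sup.2 ⟨twistedD η z', ?_, twistedD η (z - z'), ⟨_, ?_, rfl⟩, ?_⟩
    · rw [h1]
      exact neg_mem (degreeFiltration_antitone (by omega) (mulLeft_mem_degreeFiltration η
        (degreePart_mem_degreeFiltration le_rfl _)))
    · exact degreeFiltration_antitone (by omega) h4
    · rw [← map_add, add_sub_cancel]

/-- A value of the Massey product comes from a cycle `z` representing `c` with `D z = -w`, where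
the closed form `w` represents the value. -/
theorem exists_cycle_of_mem_masseyProduct {η : DiffForm E X 3} {m p : ℕ} {c : deRhamH E X p}
    {μ : deRhamH E X (p + (2 * m + 3))} (hμ : μ ∈ masseyProduct η m c) :
    ∃ (z : cycles (twistedD η) (degreeFiltration E X) (2 * m + 3) p)
      (w : closedForms E X (p + (2 * m + 3))), IsRepresentedBy (pageClass z) c ∧
        twistedD η z = -w ∧ cohomologyClass w = μ := by
  obtain ⟨a, x, w, hx, hc, ha, hw, hμ⟩ := hμ
  have haF : ∀ j, homogeneous E X _ (a j) ∈ degreeFiltration E X (p + 2 * j) := fun j =>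
    mem_degreeFiltration_of_degreePart_eq (degreePart_homogeneous_self _ _)
  have hD : twistedD η (∑ j ∈ Finset.range (m + 1), homogeneous E X _ (a j)) = -w := by
    rw [hw]
    refine twistedD_sum_range η (fun j => homogeneous E X _ (a j)) m ?_ ha
    rw [← hx]
    exact (mem_closedForms.1 x.2).2
  refine ⟨⟨∑ j ∈ Finset.range (m + 1), homogeneous E X _ (a j), ?_, ?_⟩, w, ?_, hD, hμ⟩
  · exact sum_mem fun j _ => degreeFiltration_antitone (by omega) (haF j)
  · change twistedD η _ ∈ degreeFiltration E X (p + (2 * m + 3))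
    rw [hD]
    exact neg_mem (mem_degreeFiltration_of_degreePart_eq (mem_closedForms.1 w.2).1)
  · refine ⟨x, _, hc, rfl, ?_⟩
    rw [hx]
    exact sum_range_sub_mem_degreeFiltration (fun j => homogeneous E X _ (a j)) m haF

theorem masseyProduct_nonempty_of_isRepresentedBy {η : DiffForm E X 3} (hη : extD 3 η = 0)
    {m p : ℕ} {c : deRhamH E X p} {u : TwistedPage η (2 * m + 3) p} (h : IsRepresentedBy u c) :
    (masseyProduct η m c).Nonempty := by
  obtain ⟨x, z, hc, rfl, hz⟩ := h
  have hxz : (x : DeRham E X) = degreePart E X p z := by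
    rw [(sub_mem_degreeFiltration_succ z.2.1 (mem_degreeFiltration_of_degreePart_eq
      (mem_closedForms.1 x.2).1)).1 hz, (mem_closedForms.1 x.2).1]
  have hw : mulLeft η (degreePart E X (p + 2 * m) z) ∈ closedForms E X (p + (2 * m + 3)) := by
    refine mem_closedForms.2 ⟨?_, ?_⟩
    · exact (degreePart_mulLeft η (p + 2 * m) _).trans (by rw [degreePart_degreePart_self])
    · rw [deRhamD_mulLeft hη]
      -- `d a_m` is `0` for `m = 0` and `η ∧ a_{m-1}` otherwise; both are annihilated by `η`
      cases m with
      | zero =>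
        have h0 : degreePart E X (p + 2 * 0) (z : DeRham E X) = x := hxz.symm
        rw [h0, (mem_closedForms.1 x.2).2, map_zero, neg_zero]
      | succ m =>
        rw [deRhamD_degreePart_of_mem_cycles η (by omega) z.2, mulLeft_mulLeft_self, neg_zero]
  exact ⟨_, fun j => component E X (p + 2 * j) z, x, ⟨_, hw⟩, hxz, hc,
    fun j hj => deRhamD_degreePart_of_mem_cycles η (by omega) z.2, rfl, rfl⟩

end SpectralSequence

end

theorem proposition6p1 {E : Type*} [NormedAddCommGroup E] [NormedSpace ℝ E]
    [FiniteDimensional ℝ E] {X : Type*} [TopologicalSpace X] [ChartedSpace E X]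
    [IsManifold 𝓘(ℝ, E) ∞ X] (η : DiffForm E X 3) (hη : extD 3 η = 0) :
    ∃ hD : ∀ θ : DeRham E X, twistedD η (twistedD η θ) = 0,
      -- the second page is de Rham cohomology
      (∃ φ : ∀ p, deRhamH E X p ≃ₗ[ℝ] TwistedPage η 2 p, ∀ p c, IsRepresentedBy (φ p c) c) ∧
      -- so is the third page, and `d_3` is multiplication by `-η`
      (∃ φ : ∀ p, deRhamH E X p ≃ₗ[ℝ] TwistedPage η 3 p, (∀ p c, IsRepresentedBy (φ p c) c) ∧
        ∀ (p : ℕ) (x : closedForms E X p), ∃ y : closedForms E X (p + 3),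
          (y : DeRham E X) = mulLeft η x ∧
          FilteredModule.pageD hD (degreeFiltration E X) 3 p (φ p (cohomologyClass x)) =
            -φ (p + 3) (cohomologyClass y)) ∧
      -- the differentials of even index vanish
      (∀ k p, FilteredModule.pageD hD (degreeFiltration E X) (2 * k) p = 0) ∧
      -- the differentials `d_{2m+3}` are the negatives of the iterated Massey products
      ∀ m p,
        (∀ u : TwistedPage η (2 * m + 3) p, ∃ c, IsRepresentedBy u c) ∧
        (∀ (c : deRhamH E X p) (u u' : TwistedPage η (2 * m + 3) p),
          IsRepresentedBy u c → IsRepresentedBy u' c → u = u') ∧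
        (∀ c : deRhamH E X p, (∃ u : TwistedPage η (2 * m + 3) p, IsRepresentedBy u c) ↔
          (masseyProduct η m c).Nonempty) ∧
        (∀ (c : deRhamH E X p) (u : TwistedPage η (2 * m + 3) p), IsRepresentedBy u c →
          ∀ μ ∈ masseyProduct η m c,
            IsRepresentedBy
              (FilteredModule.pageD hD (degreeFiltration E X) (2 * m + 3) p u) (-μ)) := by
  refine ⟨twistedD_twistedD hη, ⟨cohomologyEquivPage η le_rfl (by norm_num),
    isRepresentedBy_cohomologyEquivPage η _ _⟩, ⟨cohomologyEquivPage η (by norm_num) le_rfl,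
    isRepresentedBy_cohomologyEquivPage η _ _, fun p x => ⟨⟨_, mulLeft_mem_closedForms hη x⟩, rfl,
      ?_⟩⟩, pageD_even_eq_zero _, fun m p => ⟨exists_isRepresentedBy (by omega),
    fun c u u' h h' => h.unique (by omega) h', fun c => ⟨?_, ?_⟩, ?_⟩⟩
  · exact pageD_cohomologyEquivPage _ p x _ rfl
  · rintro ⟨u, hu⟩
    exact masseyProduct_nonempty_of_isRepresentedBy hη hu
  · rintro ⟨μ, hμ⟩
    obtain ⟨z, -, hz, -⟩ := exists_cycle_of_mem_masseyProduct hμ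
    exact ⟨_, hz⟩
  · intro c u hu μ hμ
    obtain ⟨z, w, hz, hw, rfl⟩ := exists_cycle_of_mem_masseyProduct hμ
    obtain rfl := hu.unique (by omega) hz
    refine ⟨-w, _, rfl, rfl, ?_⟩
    change twistedD η z - ((-w : closedForms E X (p + (2 * m + 3))) : DeRham E X) ∈
      degreeFiltration E X (p + (2 * m + 3) + 1)
    rw [hw, Submodule.coe_neg, sub_self]
    exact zero_mem _
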